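/- **Convolutional generators.** Signals live on a periodic $D$-dimensional grid ($D=1$ for vectors, $D=2$ for images). For a signal $z$ on such a grid and a kernel $c$ with $\ell$ taps per direction let $T(c)z$ be the circular convolution $(T(c)z)_p=\sum_q c_q z_{p+q}$. A convolutional generator with $d\ge 1$ layers and $k$ channels maps a fixed input volume $B_0\in\mathbb R^{n_0\times k}$ and parameters $C$ to $$B_{i+1}=\mathrm{relu}\Big(\Big[\sum_{j=1}^k T(c_{isj})U_i b_{ij}\Big]_{s=1,\dots,k}\Big)\quad(0\le i<d),\qquad G(C)=\phi(B_dC_d),$$ where $b_{ij}$ is the $j$-th channel (column) of $B_i$, each $U_i$ is either the identity or upsampling by the factor two in every direction by inserting zeros, $C_d\in\mathbb R^{k\times k_{\rm out}}$, and $\phi$ is the identity or the entrywise sigmoid. In each layer the filters are either fixed up to a learnable scalar, $c_{isj}=\theta_{isj}w_i$ with a fixed kernel $w_i$, or fully learnable. The parameter vector $C\in\mathbb R^N$ collects all $N$ learnable numbers of all filters together with the entries of $C_d$, and $G(C)\in\mathbb R^n$. Let $\kappa\ge 0$ be a number such that in every layer the linear operator "upsample, then convolve" has Euclidean operator norm at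 most $\kappa$: this operator is $z\mapsto T(w_i)U_iz$ for a fixed kernel, and $(z_q)_q\mapsto\sum_q T(e_q)U_iz_q$, with $q$ running over the taps and $e_q$ the unit kernel at $q$, for learnable filters. (For suitably scaled fixed kernels one may take $\kappa=1$; for learnable filters with $L$ taps in total, $\kappa=\sqrt L$.) **Theorem.** There are absolute constants $K,c>0$ such that the following holds for every convolutional generator $G$ as above whose input volume has spectral norm $\|B_0\|\le\xi$. Let $\mu>0$, let $\mathcal B(\mu)=\{C\in\mathbb R^N:\|C\|_2\le\mu\}$, and let $\delta>0$ be a slack parameter which, if $\kappa\mu>1$, satisfies $\kappa\delta\le d\,\xi$. Let $x^*\in\mathbb R^n$ and let $A\in\mathbb R^{m\times n}$ have i.i.d. $\mathcal N(0,1/m)$ entries, where $$m\ \ge\ K\,N\,d\,\log\!\big(d\,\xi\,\mu/\delta\big).$$ Then the minimum of $\|G(C)-x^*\|_2$ over $C\in\mathcal B(\mu)$ is attained, and with probability at least $1-e^{-cm}$ the matrix $A$ has the following property: for every noise vector $\eta\in\mathbb R^m$ with $y=Ax^*+\eta$, every $\epsilon$, and every $\hat C\in\mathcal B(\mu)$ that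 minimizes $\|y-AG(C)\|_2$ over $\mathcal B(\mu)$ to within an additive $\epsilon$ of the optimum, $$\|G(\hat C)-x^*\|_2\ \le\ 6\min_{C^*\in\mathcal B(\mu)}\|G(C^*)-x^*\|_2+3\|\eta\|_2+2\epsilon+2\delta .$$ (For $m=0$ the measurement is empty and the probability bound is trivial. The convention $\log 0=0$ is used if $\xi=0$.) -/

import Mathlib

open MeasureTheory ProbabilityTheory

noncomputable section

namespace ConvNet

/-- The convolution filters of one layer, supported on a `D`-dimensional grid of taps with `ℓ` taps
per direction: either a fixed kernel `w` that is only multiplied by a learnable scalar, or a kernel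
all of whose taps are learnable. -/
inductive FilterKind (D ℓ : ℕ) : Type
  | fixed (w : (Fin D → Fin ℓ) → ℝ) : FilterKind D ℓ
  | learned : FilterKind D ℓ

/-- Index type of the learnable numbers in one filter. -/
def FilterKind.Coeff {D ℓ : ℕ} : FilterKind D ℓ → Type
  | .fixed _ => Unit
  | .learned => Fin D → Fin ℓ

instance FilterKind.fintypeCoeff {D ℓ : ℕ} : (F : FilterKind D ℓ) → Fintype F.Coeff
  | .fixed _ => inferInstanceAs (Fintype Unit)
  | .learned => inferInstanceAs (Fintype (Fin D → Fin ℓ))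

instance FilterKind.decidableEqCoeff {D ℓ : ℕ} : (F : FilterKind D ℓ) → DecidableEq F.Coeff
  | .fixed _ => inferInstanceAs (DecidableEq Unit)
  | .learned => inferInstanceAs (DecidableEq (Fin D → Fin ℓ))

/-- The convolution kernel determined by the learnable numbers `c`. -/
def FilterKind.kernel {D ℓ : ℕ} :
    (F : FilterKind D ℓ) → (F.Coeff → ℝ) → (Fin D → Fin ℓ) → ℝ
  | .fixed w, c => fun q => c () * w q
  | .learned, c => c

/-- The pixels of a `D`-dimensional grid with `s a` pixels in direction `a`. -/
abbrev Pixels {D : ℕ} (s : Fin D → ℕ) : Type := (a : Fin D) → Fin (s a)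

/-- Upsampling by the factor `f` in every direction by inserting zeros; for `f = 1` this is the
identity. -/
def upsample {D : ℕ} {s : Fin D → ℕ} (f : ℕ) (x : Pixels s → ℝ) :
    Pixels (fun a => f * s a) → ℝ :=
  fun p => if ∀ a, f ∣ (p a : ℕ) then
    x (fun a => ⟨(p a : ℕ) / f, Nat.div_lt_of_lt_mul (p a).isLt⟩) else 0

/-- Circular convolution with the kernel `c`, given in one dimension by the circulant matrix with
first row `(c₁, …, c_ℓ, 0, …, 0)`. -/
def conv {D ℓ : ℕ} {s : Fin D → ℕ} (c : (Fin D → Fin ℓ) → ℝ) (z : Pixels s → ℝ) :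
    Pixels s → ℝ :=
  fun p => ∑ q : Fin D → Fin ℓ, c q *
    z (fun a => ⟨((p a : ℕ) + (q a : ℕ)) % s a, Nat.mod_lt _ (Nat.zero_lt_of_lt (p a).isLt)⟩)

/-- The map applied entrywise to the last linear combination of the channels. -/
inductive OutputMap : Type
  | identity : OutputMap
  | sigmoid : OutputMap

def OutputMap.apply : OutputMap → ℝ → ℝ
  | .identity, t => t
  | .sigmoid, t => Real.sigmoid t

/-- A convolutional generator: `depth` convolutional ReLU layers with `channels` channels, acting on
a fixed input volume, followed by a linear combination of the channels. The spatial dimension `dim`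
is `1` for signals and `2` for images. Only the values of `up` and `filter` at layers `i < depth`
matter. -/
structure ConvGenerator : Type where
  dim : ℕ
  depth : ℕ
  channels : ℕ
  outChannels : ℕ
  taps : ℕ
  inputSize : Fin dim → ℕ
  input : Matrix (Pixels inputSize) (Fin channels) ℝ
  up : ℕ → Bool
  filter : ℕ → FilterKind dim taps
  output : OutputMap

namespace ConvGenerator

/-- The upsampling factor of layer `i`. -/
def factor (G : ConvGenerator) (i : ℕ) : ℕ := if G.up i then 2 else 1

/-- The spatial size of the volume `B i`. -/
def size (G : ConvGenerator) : ℕ → Fin G.dim → ℕ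
  | 0 => G.inputSize
  | i + 1 => fun a => G.factor i * size G i a

/-- Index type of all learnable parameters. The entry `(i, c, s, j)` is the learnable number `c` of
the filter in layer `i` from the input channel `j` to the output channel `s`; the remaining entries
are the weights of the final linear combinations. -/
abbrev ParamIndex (G : ConvGenerator) : Type :=
  (Σ i : Fin G.depth, (G.filter i).Coeff × Fin G.channels × Fin G.channels) ⊕
    (Fin G.channels × Fin G.outChannels)

/-- The parameter space, with the Euclidean norm. -/
abbrev Params (G : ConvGenerator) : Type := EuclideanSpace ℝ G.ParamIndex

/-- The number of parameters. -/
def numParams (G : ConvGenerator) : ℕ := Fintype.card G.ParamIndex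

/-- Index type of the entries of the generated signal. -/
abbrev OutIndex (G : ConvGenerator) : Type := Pixels (G.size G.depth) × Fin G.outChannels

/-- The signal space, with the Euclidean norm. -/
abbrev Signal (G : ConvGenerator) : Type := EuclideanSpace ℝ G.OutIndex

/-- Layer `i`: output channel `s` is the ReLU of the sum, over the input channels `j`, of the
upsampled channel `j` convolved with the filter `(s, j)`. -/
def layer (G : ConvGenerator) (i : ℕ)
    (θ : (G.filter i).Coeff × Fin G.channels × Fin G.channels → ℝ)
    (B : Matrix (Pixels (G.size i)) (Fin G.channels) ℝ) :
    Matrix (Pixels (G.size (i + 1))) (Fin G.channels) ℝ :=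
  Matrix.of fun p s => max 0 (∑ j : Fin G.channels,
    conv ((G.filter i).kernel fun c => θ (c, s, j)) (upsample (G.factor i) fun p' => B p' j) p)

/-- The volume after `i` layers. -/
def volume (G : ConvGenerator) (C : G.Params) :
    (i : ℕ) → i ≤ G.depth → Matrix (Pixels (G.size i)) (Fin G.channels) ℝ
  | 0, _ => G.input
  | i + 1, h => G.layer i (fun t => C (Sum.inl ⟨⟨i, h⟩, t⟩))
      (volume G C i (Nat.le_of_succ_le h))

/-- The generated signal. -/
def generate (G : ConvGenerator) (C : G.Params) : G.Signal :=
  WithLp.toLp 2 fun t => G.output.apply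
    (∑ j : Fin G.channels, G.volume C G.depth le_rfl t.1 j * C (Sum.inr (j, t.2)))

open scoped Matrix.Norms.L2Operator in
/-- The spectral norm of the input volume. -/
def inputNorm (G : ConvGenerator) : ℝ := ‖G.input‖

/-- The linear operator of upsampling followed by convolution in layer `i` has Euclidean operator
norm at most `κ`. For a fixed kernel `w` the operator is `z ↦ conv w (upsample z)`; for learned
filters it maps a family `z`, indexed by the taps, to the sum of the upsampled and accordingly
shifted signals `z c`, so that its norm is at most the square root of the number of taps. -/
def LayerNormLE (G : ConvGenerator) (i : ℕ) (κ : ℝ) : Prop :=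
  ∀ z : (G.filter i).Coeff → EuclideanSpace ℝ (Pixels (G.size i)),
    ‖(WithLp.toLp 2 (fun p => ∑ c, conv ((G.filter i).kernel (Pi.single c 1))
        (upsample (G.factor i) (z c)) p) : EuclideanSpace ℝ (Pixels (G.size (i + 1))))‖
      ≤ κ * √(∑ c, ‖z c‖ ^ 2)

end ConvGenerator

/-- The law of the entries of a random matrix with `m` rows and independent `N(0, 1/m)` entries. -/
def gaussianMatrix (m : ℕ) (ι : Type) [Fintype ι] : Measure (Fin m → ι → ℝ) :=
  Measure.pi fun _ : Fin m => Measure.pi fun _ : ι => gaussianReal 0 (1 / (m : NNReal))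

end ConvNet

end

/-!
Layer by layer, a generator is Lipschitz on the ball of radius `μ`, because each layer is a bilinear
map of bounded norm followed by a contraction. Hence a net of the parameter ball is carried to a net
of the range, of cardinality exponential in `N` times the logarithm of the resolution. A fixed
vector keeps its norm under a Gaussian matrix up to exponentially small probability (Chernoff), and
chaining along nets at the scales `2 ^ (-i) * δ / 10` extends the lower bound to all differences
`v - u`, where `v` is in the range and `u` is a best approximation of `x`, up to an additive
multiple of `δ`.

The logarithm may be negative, or too small to pay for the coarsest net. Then `κ * μ`, if larger
than `1`, is so close to it that the whole range is within distance `δ` of its value at `0`.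
-/

namespace ConvNet

section Gaussian

open Real
open scoped NNReal ENNReal

theorem map_sum_mul_pi_gaussianReal {ι : Type*} [Fintype ι] (w : ℝ≥0) (v : EuclideanSpace ℝ ι) :
    (Measure.pi fun _ : ι ↦ gaussianReal 0 w).map (fun a ↦ ∑ j, a j * v j)
      = gaussianReal 0 (w * ‖v‖₊ ^ 2) := by
  have hLp : ∀ j, MemLp (fun x ↦ x * v j) 2 (gaussianReal 0 w) :=
    fun j ↦ IsGaussian.memLp_two_id.mul_const _
  have hlaw : HasGaussianLaw (fun a : ι → ℝ ↦ ∑ j, a j * v j)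
      (Measure.pi fun _ : ι ↦ gaussianReal 0 w) := by
    refine iIndepFun.hasGaussianLaw_fun_sum (fun j ↦ ?_)
      (iIndepFun_pi fun j ↦ (hLp j).aestronglyMeasurable.aemeasurable)
    have hj : HasLaw (Function.eval j) (gaussianReal 0 w)
        (Measure.pi fun _ : ι ↦ gaussianReal 0 w) :=
      (measurePreserving_eval (fun _ : ι ↦ gaussianReal 0 w) j).hasLaw
    exact (gaussianReal_mul_const hj (v j)).hasGaussianLaw
  have hmean : ∫ a : ι → ℝ, ∑ j, a j * v j ∂(Measure.pi fun _ ↦ gaussianReal 0 w) = 0 := by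
    rw [integral_finsetSum]
    · simp [integral_mul_const, integral_eval]
    · exact fun j _ ↦ ((hLp j).comp_measurePreserving
        (measurePreserving_eval _ j)).integrable one_le_two
  have hvar : Var[fun a : ι → ℝ ↦ ∑ j, a j * v j; Measure.pi fun _ ↦ gaussianReal 0 w]
      = w * ‖v‖ ^ 2 := by
    rw [← Finset.sum_fn, variance_sum_pi hLp, EuclideanSpace.real_norm_sq_eq, Finset.mul_sum]
    refine Finset.sum_congr rfl fun j _ ↦ ?_
    rw [variance_mul_const, variance_fun_id_gaussianReal]
  rw [hlaw.map_eq_gaussianReal, hmean, hvar]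
  congr 1
  ext
  rw [Real.coe_toNNReal _ (by positivity)]
  simp

theorem mgf_sq_gaussianReal {w : ℝ≥0} {t : ℝ} (ht : 2 * t * w < 1) :
    mgf (fun x ↦ x ^ 2) (gaussianReal 0 w) t = (√(1 - 2 * t * w))⁻¹ := by
  obtain rfl | hw := eq_or_ne w 0
  · simp [mgf]
  have : (0 : ℝ) < w := by positivity
  have hdensity : ∀ x : ℝ, gaussianPDFReal 0 w x • exp (t * x ^ 2)
      = (√(2 * π * w))⁻¹ * exp (-((1 - 2 * t * w) / (2 * w)) * x ^ 2) := by
    intro x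
    rw [gaussianPDFReal, smul_eq_mul, mul_assoc, ← exp_add]
    congr 2
    field_simp
    ring
  simp_rw [mgf, integral_gaussianReal_eq_integral_smul hw, hdensity]
  rw [integral_const_mul, integral_gaussian, ← sqrt_inv, ← sqrt_mul (by positivity), ← sqrt_inv]
  congr 1
  have : 1 - 2 * t * w ≠ 0 := by linarith
  field_simp

instance isProbabilityMeasure_gaussianMatrix (m : ℕ) (ι : Type) [Fintype ι] :
    IsProbabilityMeasure (gaussianMatrix m ι) := by
  unfold gaussianMatrix
  infer_instance

variable {ι : Type} [Fintype ι] [DecidableEq ι] {m : ℕ}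

theorem norm_sq_toEuclideanLin_of (A : Fin m → ι → ℝ) (v : EuclideanSpace ℝ ι) :
    ‖Matrix.toEuclideanLin (Matrix.of A) v‖ ^ 2 = ∑ i, (∑ j, A i j * v j) ^ 2 := by
  simp [EuclideanSpace.real_norm_sq_eq, Matrix.toLpLin_apply, Matrix.mulVec, dotProduct]

theorem mgf_norm_sq_gaussianMatrix {v : EuclideanSpace ℝ ι} {t : ℝ}
    (ht : 2 * t * (‖v‖ ^ 2 / m) < 1) :
    mgf (fun A ↦ ‖Matrix.toEuclideanLin (Matrix.of A) v‖ ^ 2) (gaussianMatrix m ι) t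
      = (√(1 - 2 * t * (‖v‖ ^ 2 / m)))⁻¹ ^ m := by
  have hrow : mgf (fun a : ι → ℝ ↦ (∑ j, a j * v j) ^ 2)
      (Measure.pi fun _ ↦ gaussianReal 0 (1 / (m : ℝ≥0))) t
      = (√(1 - 2 * t * (‖v‖ ^ 2 / m)))⁻¹ := by
    have hw : ((1 / (m : ℝ≥0) * ‖v‖₊ ^ 2 : ℝ≥0) : ℝ) = ‖v‖ ^ 2 / m := by
      push_cast
      ring
    rw [← hw, ← mgf_sq_gaussianReal (by rwa [hw]), ← map_sum_mul_pi_gaussianReal,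
      mgf_map (Measurable.aemeasurable (by fun_prop)) (by fun_prop)]
    rfl
  rw [← hrow, mgf, mgf]
  simp_rw [norm_sq_toEuclideanLin_of, Finset.mul_sum, exp_sum]
  rw [gaussianMatrix, integral_fintype_prod_eq_pow
    (f := fun a : ι → ℝ ↦ exp (t * (∑ j, a j * v j) ^ 2)), Fintype.card_fin]

theorem inv_sqrt_one_sub_two_mul_le {b : ℝ} (hb : b < 1 / 2) :
    (√(1 - 2 * b))⁻¹ ≤ exp (b / (1 - 2 * b)) := by
  have hb' : 0 < 1 - 2 * b := by linarith
  rw [← sqrt_inv, sqrt_le_left (by positivity), ← exp_nat_mul]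
  convert add_one_le_exp ((2 : ℕ) * (b / (1 - 2 * b))) using 1
  push_cast
  field_simp
  ring

theorem integrable_and_mgf_norm_sq_gaussianMatrix_le (hm : m ≠ 0) {v : EuclideanSpace ℝ ι}
    (hv : v ≠ 0) {b : ℝ} (hb : b < 1 / 2) :
    Integrable (fun A ↦ exp (b * (m / ‖v‖ ^ 2) * ‖Matrix.toEuclideanLin (Matrix.of A) v‖ ^ 2))
        (gaussianMatrix m ι) ∧
      mgf (fun A ↦ ‖Matrix.toEuclideanLin (Matrix.of A) v‖ ^ 2) (gaussianMatrix m ι)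
        (b * (m / ‖v‖ ^ 2)) ≤ exp (m * (b / (1 - 2 * b))) := by
  have : 0 < ‖v‖ := norm_pos_iff.2 hv
  have hb' : 2 * (b * (m / ‖v‖ ^ 2)) * (‖v‖ ^ 2 / m) = 2 * b := by field_simp
  have hmgf := mgf_norm_sq_gaussianMatrix (m := m) (v := v) (t := b * (m / ‖v‖ ^ 2))
    (by rw [hb']; linarith)
  rw [hb'] at hmgf
  refine ⟨mgf_pos_iff.1 ?_, ?_⟩
  · have : 0 < √(1 - 2 * b) := sqrt_pos.2 (by linarith)
    rw [hmgf]
    positivity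
  · rw [hmgf, exp_nat_mul]
    gcongr
    exact inv_sqrt_one_sub_two_mul_le hb

theorem gaussianMatrix_norm_gt_le (hm : m ≠ 0) (v : EuclideanSpace ℝ ι) {s : ℝ} (hs : 2 ≤ s) :
    gaussianMatrix m ι {A | s * ‖v‖ < ‖Matrix.toEuclideanLin (Matrix.of A) v‖}
      ≤ ENNReal.ofReal (exp (-(s ^ 2 / 8) * m)) := by
  obtain rfl | hv := eq_or_ne v 0
  · simp
  have : 0 < ‖v‖ := norm_pos_iff.2 hv
  obtain ⟨hint, hmgf⟩ :=
    integrable_and_mgf_norm_sq_gaussianMatrix_le hm hv (b := 1 / 4) (by norm_num)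
  have hchernoff := measure_ge_le_exp_mul_mgf ((s * ‖v‖) ^ 2) (by positivity) hint
  calc gaussianMatrix m ι {A | s * ‖v‖ < ‖Matrix.toEuclideanLin (Matrix.of A) v‖}
      ≤ gaussianMatrix m ι {A | (s * ‖v‖) ^ 2 ≤ ‖Matrix.toEuclideanLin (Matrix.of A) v‖ ^ 2} :=
        measure_mono fun A (hA : _ < _) ↦ pow_le_pow_left₀ (by positivity) hA.le 2
    _ ≤ ENNReal.ofReal (exp (-(1 / 4 * (m / ‖v‖ ^ 2)) * (s * ‖v‖) ^ 2)
          * exp (m * (1 / 4 / (1 - 2 * (1 / 4))))) := by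
        rw [← ofReal_measureReal]
        exact ENNReal.ofReal_le_ofReal (hchernoff.trans (by gcongr))
    _ ≤ ENNReal.ofReal (exp (-(s ^ 2 / 8) * m)) := by
        rw [← exp_add]
        refine ENNReal.ofReal_le_ofReal (exp_le_exp.2 ?_)
        have hexponent : -(1 / 4 * (m / ‖v‖ ^ 2)) * (s * ‖v‖) ^ 2
            + m * (1 / 4 / (1 - 2 * (1 / 4))) = -(s ^ 2 / 8) * m - (s ^ 2 - 4) / 8 * m := by
          field_simp
          ring
        have : 0 ≤ (s ^ 2 - 4) / 8 * m := mul_nonneg (by nlinarith) m.cast_nonneg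
        linarith

theorem gaussianMatrix_norm_lt_le (hm : m ≠ 0) (v : EuclideanSpace ℝ ι) :
    gaussianMatrix m ι {A | ‖Matrix.toEuclideanLin (Matrix.of A) v‖ < 4 / 5 * ‖v‖}
      ≤ ENNReal.ofReal (exp (-(1 / 50) * m)) := by
  obtain rfl | hv := eq_or_ne v 0
  · simp
  have : 0 < ‖v‖ := norm_pos_iff.2 hv
  obtain ⟨hint, hmgf⟩ :=
    integrable_and_mgf_norm_sq_gaussianMatrix_le hm hv (b := -(1 / 8)) (by norm_num)
  have hchernoff := measure_le_le_exp_mul_mgf ((4 / 5 * ‖v‖) ^ 2)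
    (mul_nonpos_of_nonpos_of_nonneg (by norm_num) (by positivity)) hint
  calc gaussianMatrix m ι {A | ‖Matrix.toEuclideanLin (Matrix.of A) v‖ < 4 / 5 * ‖v‖}
      ≤ gaussianMatrix m ι {A | ‖Matrix.toEuclideanLin (Matrix.of A) v‖ ^ 2 ≤ (4 / 5 * ‖v‖) ^ 2} :=
        measure_mono fun A (hA : _ < _) ↦ pow_le_pow_left₀ (norm_nonneg _) hA.le 2
    _ ≤ ENNReal.ofReal (exp (-(-(1 / 8) * (m / ‖v‖ ^ 2)) * (4 / 5 * ‖v‖) ^ 2)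
          * exp (m * (-(1 / 8) / (1 - 2 * -(1 / 8))))) := by
        rw [← ofReal_measureReal]
        exact ENNReal.ofReal_le_ofReal (hchernoff.trans (by gcongr))
    _ = ENNReal.ofReal (exp (-(1 / 50) * m)) := by
        rw [← exp_add]
        congr 2
        field_simp
        norm_num

theorem measurable_norm_toEuclideanLin_of (v : EuclideanSpace ℝ ι) :
    Measurable fun A : Fin m → ι → ℝ ↦ ‖Matrix.toEuclideanLin (Matrix.of A) v‖ := by
  have hsqrt (A : Fin m → ι → ℝ) : ‖Matrix.toEuclideanLin (Matrix.of A) v‖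
      = √(∑ i, (∑ j, A i j * v j) ^ 2) := by
    rw [← norm_sq_toEuclideanLin_of, sqrt_sq (norm_nonneg _)]
  simp_rw [hsqrt]
  fun_prop

end Gaussian

section CoveringNumber

open Metric Module
open scoped NNReal

variable {E : Type*} [NormedAddCommGroup E] [NormedSpace ℝ E] [FiniteDimensional ℝ E]
  {ρ : ℝ} {ε : ℝ≥0}

theorem card_le_of_isSeparated_of_subset_closedBall (hρ : 0 ≤ ρ) (hε : 0 < ε) {s : Finset E}
    (hs : (s : Set E) ⊆ closedBall 0 ρ) (hsep : IsSeparated ε (s : Set E)) :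
    (s.card : ℝ) ≤ (1 + 2 * ρ / ε) ^ finrank ℝ E := by
  borelize E
  let ν : Measure E := Measure.addHaar
  have hε' : (0 : ℝ) < ε := hε
  have hdisj : (s : Set E).PairwiseDisjoint fun c ↦ ball c (ε / 2) := by
    intro c hc d hd hcd
    have hcd' : (ε : ENNReal) < nndist c d := edist_nndist c d ▸ hsep hc hd hcd
    have : (ε : ℝ) < dist c d := mod_cast hcd'
    exact ball_disjoint_ball (by linarith)
  have hsub : (⋃ c ∈ s, ball c (ε / 2 : ℝ)) ⊆ ball 0 (ε / 2 + ρ) :=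
    Set.iUnion₂_subset fun c hc ↦ ball_subset_ball' (by gcongr; exact hs hc)
  have hvol : (s.card : ENNReal) * ENNReal.ofReal ((ε / 2 : ℝ) ^ finrank ℝ E) * ν (ball 0 1)
      ≤ ENNReal.ofReal ((ε / 2 + ρ) ^ finrank ℝ E) * ν (ball 0 1) :=
    calc _ = ν (⋃ c ∈ s, ball c (ε / 2)) := by
          rw [measure_biUnion_finset hdisj fun c _ ↦ measurableSet_ball]
          simp [ν.addHaar_ball_of_pos _ (half_pos hε'), mul_assoc]
      _ ≤ ν (ball 0 (ε / 2 + ρ)) := measure_mono hsub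
      _ = _ := ν.addHaar_ball_of_pos _ (by positivity)
  have hcard := ENNReal.toReal_le_of_le_ofReal (by positivity)
    ((ENNReal.mul_le_mul_iff_left (measure_ball_pos ν _ one_pos).ne' measure_ball_lt_top.ne).1 hvol)
  rw [ENNReal.toReal_mul, ENNReal.toReal_ofReal (by positivity), ENNReal.toReal_natCast,
    ← le_div_iff₀ (by positivity), ← div_pow] at hcard
  have hratio : (ε / 2 + ρ) / (ε / 2) = 1 + 2 * ρ / ε := by field_simp
  rwa [hratio] at hcard

theorem exists_isCover_closedBall (hρ : 0 ≤ ρ) (hε : 0 < ε) :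
    ∃ s : Finset E, (s : Set E) ⊆ closedBall 0 ρ ∧ IsCover ε (closedBall (0 : E) ρ) s ∧
      (s.card : ℝ) ≤ (1 + 2 * ρ / ε) ^ finrank ℝ E := by
  have hfin : packingNumber ε (closedBall (0 : E) ρ) ≠ ⊤ := by
    obtain ⟨t, -, ht, hcover⟩ := exists_finite_isCover_of_isCompact (half_pos hε).ne'
      (isCompact_closedBall (0 : E) ρ)
    refine ne_top_of_le_ne_top (Set.encard_ne_top_iff.2 ht) ?_
    calc packingNumber ε (closedBall (0 : E) ρ)
        = packingNumber (2 * (ε / 2)) (closedBall (0 : E) ρ) := by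
          rw [mul_div_cancel₀ _ two_ne_zero]
      _ ≤ externalCoveringNumber (ε / 2) (closedBall (0 : E) ρ) :=
        packingNumber_two_mul_le_externalCoveringNumber _ _
      _ ≤ t.encard := hcover.externalCoveringNumber_le_encard
  have hS : (maximalSeparatedSet ε (closedBall (0 : E) ρ)).Finite := by
    rwa [← Set.encard_ne_top_iff, encard_maximalSeparatedSet hfin]
  refine ⟨hS.toFinset, ?_, ?_, card_le_of_isSeparated_of_subset_closedBall hρ hε ?_ ?_⟩ <;>
    rw [hS.coe_toFinset]
  exacts [maximalSeparatedSet_subset, isCover_maximalSeparatedSet hfin,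
    maximalSeparatedSet_subset, isSeparated_maximalSeparatedSet]

theorem exists_isCover_image_closedBall {V : Type*} [PseudoMetricSpace V]
    {f : E → V} {L : ℝ≥0} (hL : 0 < L) (hf : LipschitzOnWith L f (closedBall 0 ρ))
    (hρ : 0 ≤ ρ) (hε : 0 < ε) :
    ∃ s : Finset V, IsCover ε (f '' closedBall 0 ρ) s ∧
      (s.card : ℝ) ≤ (1 + 2 * (L * ρ) / ε) ^ finrank ℝ E := by
  classical
  obtain ⟨s, hs, hcover, hcard⟩ := exists_isCover_closedBall (E := E) hρ (div_pos hε hL)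
  refine ⟨s.image f, ?_, ?_⟩
  · rintro _ ⟨a, ha, rfl⟩
    obtain ⟨b, hb, hab⟩ := hcover ha
    refine ⟨f b, by simpa using ⟨b, hb, rfl⟩, ?_⟩
    calc edist (f a) (f b) ≤ L * edist a b := hf ha (hs hb)
      _ ≤ L * (ε / L : ℝ≥0) := by gcongr; exact hab
      _ = ε := by rw [← ENNReal.coe_mul, mul_div_cancel₀ _ hL.ne']
  · calc ((s.image f).card : ℝ) ≤ s.card := mod_cast Finset.card_image_le
      _ ≤ (1 + 2 * ρ / (ε / L : ℝ≥0)) ^ finrank ℝ E := hcard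
      _ = (1 + 2 * (L * ρ) / ε) ^ finrank ℝ E := by
        push_cast
        field_simp

end CoveringNumber

section RestrictedEigenvalue

open Metric
open scoped NNReal

/-- The set-restricted eigenvalue condition of Bora, Jalal, Price and Dimakis for the linear map
`T` on the set `s`, with constant `γ` and slack `δ`, where one of the two points is fixed to be
`u`. -/
def RestrictedEigenvalue {V W : Type*} [NormedAddCommGroup V] [NormedSpace ℝ V]
    [NormedAddCommGroup W] [NormedSpace ℝ W] (T : V →ₗ[ℝ] W) (s : Set V) (u : V) (γ δ : ℝ) :
    Prop :=
  ∀ v ∈ s, γ * ‖v - u‖ ≤ ‖T (v - u)‖ + δ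

section Chaining

variable {V W : Type*} [NormedAddCommGroup V] [NormedSpace ℝ V] [FiniteDimensional ℝ V]
  [NormedAddCommGroup W] [NormedSpace ℝ W] {T : V →ₗ[ℝ] W} {r : ℝ≥0}

-- The admissible stretch `(3 / 2) ^ i` at scale `i` is large enough to pay for a union bound over
-- the nets and small enough for the series of step lengths to converge.
theorem norm_map_sub_le_of_chain {v : V} {a : ℕ → V} (ha : ∀ i, dist v (a i) ≤ r / 2 ^ i)
    (hT : ∀ i, ‖T (a i - a (i + 1))‖ ≤ 2 * (3 / 2) ^ i * ‖a i - a (i + 1)‖) :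
    ‖T (v - a 0)‖ ≤ 12 * r := by
  have hstep : ∀ i, dist (T (a i)) (T (a (i + 1))) ≤ 3 * r * (3 / 4) ^ i := by
    intro i
    have hdist : ‖a i - a (i + 1)‖ ≤ r / 2 ^ i + r / 2 ^ (i + 1) := by
      rw [← dist_eq_norm]
      exact (dist_triangle_left _ _ v).trans (add_le_add (ha i) (ha (i + 1)))
    calc dist (T (a i)) (T (a (i + 1))) = ‖T (a i - a (i + 1))‖ := by rw [map_sub, dist_eq_norm]
      _ ≤ 2 * (3 / 2) ^ i * (r / 2 ^ i + r / 2 ^ (i + 1)) := (hT i).trans (by gcongr)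
      _ = 3 * r * (3 / 2 / 2) ^ i := by
        rw [div_pow (3 / 2 : ℝ) 2]
        field_simp
        ring
      _ = 3 * r * (3 / 4) ^ i := by norm_num
  have hlim : Filter.Tendsto a Filter.atTop (nhds v) := by
    refine tendsto_iff_dist_tendsto_zero.2 (squeeze_zero (fun _ ↦ dist_nonneg)
      (fun i ↦ (dist_comm (a i) v).trans_le (ha i)) ?_)
    simpa [div_eq_mul_inv] using
      (tendsto_pow_atTop_nhds_zero_of_lt_one (r := (2 : ℝ)⁻¹) (by norm_num) (by norm_num)).const_mul
        (r : ℝ)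
  have hdist := dist_le_of_le_geometric_of_tendsto₀ (3 / 4) (3 * r) (by norm_num) hstep
    (((LinearMap.continuous_of_finiteDimensional T).tendsto v).comp hlim)
  calc ‖T (v - a 0)‖ = dist (T (a 0)) (T v) := by rw [map_sub, dist_comm, dist_eq_norm]
    _ ≤ 3 * r / (1 - 3 / 4) := hdist
    _ = 12 * r := by ring

theorem restrictedEigenvalue_of_isCover {s : Set V} {S : ℕ → Finset V} {u : V}
    (hS : ∀ i, IsCover (r / 2 ^ i) s (S i))
    (hstep : ∀ i, ∀ v ∈ S i, ∀ w ∈ S (i + 1), ‖T (v - w)‖ ≤ 2 * (3 / 2) ^ i * ‖v - w‖)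
    (hcoarse : ∀ v ∈ S 0, 4 / 5 * ‖v - u‖ ≤ ‖T (v - u)‖) :
    RestrictedEigenvalue T s u (4 / 5) (13 * r) := by
  intro v hv
  choose a haS ha using fun i ↦ hS i hv
  have ha' (i : ℕ) : dist v (a i) ≤ r / 2 ^ i := by
    have hi : edist v (a i) ≤ (r / 2 ^ i : ℝ≥0) := ha i
    rw [edist_nndist, ENNReal.coe_le_coe] at hi
    exact_mod_cast hi
  have hchain : ‖T (v - a 0)‖ ≤ 12 * r :=
    norm_map_sub_le_of_chain ha' fun i ↦ hstep i _ (haS i) _ (haS (i + 1))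
  have hv₀ : ‖v - a 0‖ ≤ r := by simpa [dist_eq_norm] using ha' 0
  have hTsub : T (a 0 - u) = T (v - u) - T (v - a 0) := by rw [← map_sub, sub_sub_sub_cancel_left]
  have hTa : ‖T (a 0 - u)‖ ≤ ‖T (v - u)‖ + ‖T (v - a 0)‖ := hTsub ▸ norm_sub_le _ _
  have := norm_sub_le_norm_sub_add_norm_sub v (a 0) u
  have := hcoarse (a 0) (haS 0)
  linarith [r.coe_nonneg]

end Chaining

variable {ι : Type} [Fintype ι] [DecidableEq ι] {m : ℕ}

/-- The event that the matrix fails the hypotheses of the chaining argument on the nets `S i` or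
stretches `u - x` by a factor of more than `2`. -/
def failureEvent (m : ℕ) (S : ℕ → Finset (EuclideanSpace ℝ ι)) (u x : EuclideanSpace ℝ ι) :
    Set (Fin m → ι → ℝ) :=
  (⋃ i, ⋃ p ∈ S i ×ˢ S (i + 1), {A | 2 * (3 / 2) ^ i * ‖p.1 - p.2‖
      < ‖Matrix.toEuclideanLin (Matrix.of A) (p.1 - p.2)‖})
    ∪ (⋃ v ∈ S 0, {A | ‖Matrix.toEuclideanLin (Matrix.of A) (v - u)‖ < 4 / 5 * ‖v - u‖})
    ∪ {A | 2 * ‖u - x‖ < ‖Matrix.toEuclideanLin (Matrix.of A) (u - x)‖}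

theorem measurableSet_failureEvent (S : ℕ → Finset (EuclideanSpace ℝ ι))
    (u x : EuclideanSpace ℝ ι) : MeasurableSet (failureEvent m S u x) :=
  ((MeasurableSet.iUnion fun i ↦ (S i ×ˢ S (i + 1)).measurableSet_biUnion fun _ _ ↦
      measurableSet_lt measurable_const (measurable_norm_toEuclideanLin_of _)).union
    ((S 0).measurableSet_biUnion fun _ _ ↦
      measurableSet_lt (measurable_norm_toEuclideanLin_of _) measurable_const)).union
    (measurableSet_lt measurable_const (measurable_norm_toEuclideanLin_of _))

theorem restrictedEigenvalue_of_notMem_failureEvent {S : ℕ → Finset (EuclideanSpace ℝ ι)}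
    {u x : EuclideanSpace ℝ ι} {s : Set (EuclideanSpace ℝ ι)} {r : ℝ≥0}
    (hS : ∀ i, IsCover (r / 2 ^ i) s (S i)) {A : Fin m → ι → ℝ} (hA : A ∉ failureEvent m S u x) :
    RestrictedEigenvalue (Matrix.toEuclideanLin (Matrix.of A)) s u (4 / 5) (13 * r) ∧
      ‖Matrix.toEuclideanLin (Matrix.of A) (u - x)‖ ≤ 2 * ‖u - x‖ := by
  simp only [failureEvent, Set.mem_union, Set.mem_iUnion, Set.mem_ofPred_eq, Finset.mem_product,
    Prod.exists, exists_prop, not_or, not_exists, not_and, not_lt] at hA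
  obtain ⟨⟨hstep, hcoarse⟩, hmisfit⟩ := hA
  exact ⟨restrictedEigenvalue_of_isCover hS (fun i v hv w hw ↦ hstep i v w ⟨hv, hw⟩) hcoarse,
    hmisfit⟩

theorem measure_biUnion_le_ofReal_exp_add {Ω α : Type*} [MeasurableSpace Ω] {P : Measure Ω}
    {S : Finset α} {B : α → Set Ω} {a b : ℝ} (hS : (S.card : ℝ) ≤ Real.exp a)
    (hB : ∀ v ∈ S, P (B v) ≤ ENNReal.ofReal (Real.exp b)) :
    P (⋃ v ∈ S, B v) ≤ ENNReal.ofReal (Real.exp (a + b)) :=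
  calc P (⋃ v ∈ S, B v) ≤ ∑ v ∈ S, P (B v) := measure_biUnion_finset_le _ _
    _ ≤ S.card • ENNReal.ofReal (Real.exp b) := Finset.sum_le_card_nsmul _ _ _ hB
    _ = ENNReal.ofReal (S.card * Real.exp b) := by
      rw [nsmul_eq_mul, ENNReal.ofReal_mul (by positivity), ENNReal.ofReal_natCast]
    _ ≤ ENNReal.ofReal (Real.exp (a + b)) := by
      rw [Real.exp_add]
      gcongr

section Probability

variable {S : ℕ → Finset (EuclideanSpace ℝ ι)} {M : ℝ}

theorem ne_zero_of_mul_le (hM : Real.log 2 ≤ M) (hm : 600 * M ≤ m) : m ≠ 0 := by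
  rintro rfl
  have := Real.log_pos one_lt_two
  rw [Nat.cast_zero] at hm
  linarith

theorem exp_mul_add_le_div_two_pow (hM : Real.log 2 ≤ M) (hm : 600 * M ≤ m) (i : ℕ) :
    Real.exp ((2 * i + 3) * M + -((2 * (3 / 2) ^ i) ^ 2 / 8) * m)
      ≤ Real.exp (-(1 / 100) * m) / 2 / 2 ^ i := by
  have hbernoulli : 1 + (i : ℝ) * (5 / 4) ≤ (9 / 4) ^ i :=
    (one_add_mul_le_pow (by norm_num) i).trans_eq (by norm_num)
  have hsq : (2 * (3 / 2 : ℝ) ^ i) ^ 2 = 4 * (9 / 4) ^ i := by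
    rw [mul_pow, ← pow_mul, mul_comm i, pow_mul]
    norm_num
  calc Real.exp ((2 * i + 3) * M + -((2 * (3 / 2) ^ i) ^ 2 / 8) * m)
      ≤ Real.exp (-(1 / 100) * m - (i + 1 : ℕ) * Real.log 2) := by
        rw [Real.exp_le_exp, hsq]
        push_cast
        have : (1 + (i : ℝ) * (5 / 4)) * m ≤ (9 / 4) ^ i * m := by gcongr
        have : ((3 * i + 4 : ℝ)) * (600 * M) ≤ (3 * i + 4) * m := by gcongr
        have : ((i + 1 : ℝ)) * Real.log 2 ≤ (i + 1) * M := by gcongr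
        nlinarith [mul_nonneg i.cast_nonneg (m.cast_nonneg (α := ℝ))]
    _ = Real.exp (-(1 / 100) * m) / 2 / 2 ^ i := by
      rw [Real.exp_sub, Real.exp_nat_mul, Real.exp_log two_pos, pow_succ', div_div]

theorem gaussianMatrix_biUnion_norm_gt_le (hM : Real.log 2 ≤ M) (hm : 600 * M ≤ m)
    (hS : ∀ i : ℕ, ((S i).card : ℝ) ≤ Real.exp ((i + 1) * M)) (i : ℕ) :
    gaussianMatrix m ι (⋃ p ∈ S i ×ˢ S (i + 1), {A | 2 * (3 / 2) ^ i * ‖p.1 - p.2‖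
      < ‖Matrix.toEuclideanLin (Matrix.of A) (p.1 - p.2)‖})
      ≤ ENNReal.ofReal (Real.exp (-(1 / 100) * m) / 2 / 2 ^ i) := by
  have hcard : ((S i ×ˢ S (i + 1)).card : ℝ) ≤ Real.exp ((2 * i + 3) * M) := by
    rw [Finset.card_product, show (2 * i + 3) * M = (i + 1) * M + ((i + 1 : ℕ) + 1) * M by
      push_cast; ring, Real.exp_add, Nat.cast_mul]
    exact mul_le_mul (hS i) (hS (i + 1)) (by positivity) (by positivity)
  have hstretch : (2 : ℝ) ≤ 2 * (3 / 2) ^ i := by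
    linarith [one_le_pow₀ (n := i) (show (1 : ℝ) ≤ 3 / 2 by norm_num)]
  exact (measure_biUnion_le_ofReal_exp_add hcard fun p _ ↦
      gaussianMatrix_norm_gt_le (ne_zero_of_mul_le hM hm) (p.1 - p.2) hstretch).trans
    (ENNReal.ofReal_le_ofReal (exp_mul_add_le_div_two_pow hM hm i))

theorem gaussianMatrix_iUnion_norm_gt_le (hM : Real.log 2 ≤ M) (hm : 600 * M ≤ m)
    (hS : ∀ i : ℕ, ((S i).card : ℝ) ≤ Real.exp ((i + 1) * M)) :
    gaussianMatrix m ι (⋃ i, ⋃ p ∈ S i ×ˢ S (i + 1), {A | 2 * (3 / 2) ^ i * ‖p.1 - p.2‖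
      < ‖Matrix.toEuclideanLin (Matrix.of A) (p.1 - p.2)‖})
      ≤ ENNReal.ofReal (Real.exp (-(1 / 100) * m)) := by
  refine (measure_iUnion_le _).trans ((ENNReal.tsum_le_tsum
    (gaussianMatrix_biUnion_norm_gt_le hM hm hS)).trans_eq ?_)
  rw [← ENNReal.ofReal_tsum_of_nonneg (fun _ ↦ by positivity) (summable_geometric_two' _),
    tsum_geometric_two']

theorem gaussianMatrix_failureEvent_le (hM : Real.log 2 ≤ M) (hm : 600 * M ≤ m)
    (hS : ∀ i : ℕ, ((S i).card : ℝ) ≤ Real.exp ((i + 1) * M)) (u x : EuclideanSpace ℝ ι) :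
    gaussianMatrix m ι (failureEvent m S u x) ≤ ENNReal.ofReal (Real.exp (-(1 / 200) * m)) := by
  have hlog := Real.log_two_gt_d9
  have hm₀ := ne_zero_of_mul_le hM hm
  have hcoarse : gaussianMatrix m ι
      (⋃ v ∈ S 0, {A | ‖Matrix.toEuclideanLin (Matrix.of A) (v - u)‖ < 4 / 5 * ‖v - u‖})
      ≤ ENNReal.ofReal (Real.exp (-(1 / 100) * m)) := by
    refine (measure_biUnion_le_ofReal_exp_add (a := M) (by simpa using hS 0)
      fun v _ ↦ gaussianMatrix_norm_lt_le hm₀ (v - u)).trans ?_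
    gcongr
    linarith
  have hmisfit : gaussianMatrix m ι
      {A | 2 * ‖u - x‖ < ‖Matrix.toEuclideanLin (Matrix.of A) (u - x)‖}
      ≤ ENNReal.ofReal (Real.exp (-(1 / 100) * m)) := by
    refine (gaussianMatrix_norm_gt_le hm₀ (u - x) le_rfl).trans
      (ENNReal.ofReal_le_ofReal (Real.exp_le_exp.2 ?_))
    linarith
  have hthree : 3 * Real.exp (-(1 / 100) * m) ≤ Real.exp (-(1 / 200) * m) := by
    have hexp : 3 ≤ Real.exp (1 / 200 * m) := by
      linarith [Real.add_one_le_exp (1 / 200 * m : ℝ)]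
    calc 3 * Real.exp (-(1 / 100) * m)
        ≤ Real.exp (1 / 200 * m) * Real.exp (-(1 / 100) * m) := by gcongr
      _ = Real.exp (-(1 / 200) * m) := by rw [← Real.exp_add]; ring_nf
  refine (measure_union_le _ _).trans ((add_le_add ((measure_union_le _ _).trans
    (add_le_add (gaussianMatrix_iUnion_norm_gt_le hM hm hS) hcoarse)) hmisfit).trans ?_)
  rw [← ENNReal.ofReal_add (by positivity) (by positivity),
    ← ENNReal.ofReal_add (by positivity) (by positivity)]
  exact ENNReal.ofReal_le_ofReal (by linarith)

end Probability

end RestrictedEigenvalue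

section Recovery

open Metric Module
open scoped NNReal

/-- The predicate `p` holds with probability at least `q`. Since `p` itself need not be measurable,
it is only required to hold on a measurable event of that probability. -/
def HoldsWithProbGE {Ω : Type*} [MeasurableSpace Ω] (P : Measure Ω) (q : ℝ) (p : Ω → Prop) : Prop :=
  ∃ E, MeasurableSet E ∧ ENNReal.ofReal q ≤ P E ∧ ∀ ω ∈ E, p ω

/-- Compressed sensing of `x` with the measurement map `T` and the signal model `s` is stable:
minimizing the residual over `s` recovers `x` up to a multiple of the misfit of `u`, the noise level
and the optimization error, with slack `δ`. -/
def StableRecovery {V W : Type*} [NormedAddCommGroup V] [NormedSpace ℝ V] [NormedAddCommGroup W]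
    [NormedSpace ℝ W] (T : V →ₗ[ℝ] W) (s : Set V) (u x : V) (δ : ℝ) : Prop :=
  ∀ (η y : W) (ε : ℝ), ∀ v ∈ s, y = T x + η → (∀ v' ∈ s, ‖y - T v‖ ≤ ‖y - T v'‖ + ε) →
    ‖v - x‖ ≤ 6 * ‖u - x‖ + 3 * ‖η‖ + 2 * ε + 2 * δ

section HoldsWithProbGE

variable {Ω : Type*} [MeasurableSpace Ω] {P : Measure Ω} [IsProbabilityMeasure P] {p : Ω → Prop}

theorem HoldsWithProbGE.of_notMem {B : Set Ω} {b : ℝ} (hB : MeasurableSet B) (hb : 0 ≤ b)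
    (hPB : P B ≤ ENNReal.ofReal b) (h : ∀ ω ∉ B, p ω) : HoldsWithProbGE P (1 - b) p := by
  refine ⟨Bᶜ, hB.compl, ?_, h⟩
  rw [prob_compl_eq_one_sub hB, ENNReal.ofReal_sub _ hb, ENNReal.ofReal_one]
  exact tsub_le_tsub_left hPB 1

theorem HoldsWithProbGE.of_forall {b : ℝ} (hb : 0 ≤ b) (h : ∀ ω, p ω) :
    HoldsWithProbGE P (1 - b) p :=
  .of_notMem .empty hb (by simp) fun ω _ ↦ h ω

end HoldsWithProbGE

section StableRecovery

variable {V W : Type*} [NormedAddCommGroup V] [NormedSpace ℝ V] [NormedAddCommGroup W]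
  [NormedSpace ℝ W] {T : V →ₗ[ℝ] W} {s : Set V} {u x : V} {δ : ℝ}

theorem stableRecovery_of_norm_sub_le (h : ∀ v ∈ s, ‖v - u‖ ≤ 2 * δ) :
    StableRecovery T s u x δ := by
  intro η y ε v hv _ hopt
  have hε : 0 ≤ ε := by linarith [hopt v hv]
  have htri := norm_sub_le_norm_sub_add_norm_sub v u x
  linarith [h v hv, norm_nonneg η, norm_nonneg (u - x)]

theorem RestrictedEigenvalue.stableRecovery
    (h : RestrictedEigenvalue T s u (4 / 5) (13 / 10 * δ)) (hu : u ∈ s) (hδ : 0 ≤ δ)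
    (hmisfit : ‖T (u - x)‖ ≤ 2 * ‖u - x‖) : StableRecovery T s u x δ := by
  intro η y ε v hv hy hopt
  have hε : 0 ≤ ε := by linarith [hopt v hv]
  have hresidual : ‖y - T u‖ ≤ ‖η‖ + 2 * ‖u - x‖ := by
    have hyu : y - T u = η - T (u - x) := by
      rw [hy, map_sub]
      abel
    exact hyu ▸ (norm_sub_le _ _).trans (by gcongr)
  have himage : ‖T (v - u)‖ ≤ 2 * ‖y - T u‖ + ε := by
    have hvu : T (v - u) = (y - T u) - (y - T v) := by rw [map_sub, sub_sub_sub_cancel_left]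
    have := hvu ▸ norm_sub_le (y - T u) (y - T v)
    linarith [hopt u hu]
  have htri := norm_sub_le_norm_sub_add_norm_sub v u x
  linarith [h v hv, norm_nonneg η]

end StableRecovery

theorem one_add_mul_two_pow_le {t : ℝ} (ht : 0 ≤ t) (i : ℕ) : 1 + t * 2 ^ i ≤ (2 + t) ^ (i + 1) :=
  calc 1 + t * 2 ^ i ≤ 2 ^ i * (2 + t) := by
        linarith [one_le_pow₀ (n := i) (one_le_two (α := ℝ))]
    _ ≤ (2 + t) ^ i * (2 + t) := by
        gcongr
        linarith
    _ = (2 + t) ^ (i + 1) := (pow_succ _ _).symm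

variable {ι : Type} [Fintype ι] {E : Type*} [NormedAddCommGroup E] [NormedSpace ℝ E]
  [FiniteDimensional ℝ E] {f : E → EuclideanSpace ℝ ι} {L : ℝ≥0} {ρ δ : ℝ}

theorem exists_isCover_card_le_exp (hL : 0 < L) (hf : LipschitzOnWith L f (closedBall 0 ρ))
    (hρ : 0 ≤ ρ) {r : ℝ≥0} (hr : 0 < r) (i : ℕ) :
    ∃ S : Finset (EuclideanSpace ℝ ι), IsCover (r / 2 ^ i) (f '' closedBall 0 ρ) S ∧
      (S.card : ℝ) ≤ Real.exp ((i + 1) * (finrank ℝ E * Real.log (2 + 2 * (L * ρ) / r))) := by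
  obtain ⟨S, hS, hcard⟩ :=
    exists_isCover_image_closedBall hL hf hρ (show 0 < r / 2 ^ i by positivity)
  refine ⟨S, hS, hcard.trans ?_⟩
  have hbase : 1 + 2 * (L * ρ) / (r / 2 ^ i : ℝ≥0) = 1 + 2 * (L * ρ) / r * 2 ^ i := by
    push_cast
    field_simp
  have hexp : Real.exp ((i + 1) * (finrank ℝ E * Real.log (2 + 2 * (L * ρ) / r)))
      = ((2 + 2 * (L * ρ) / r) ^ (i + 1)) ^ finrank ℝ E := by
    rw [← Real.exp_log (show 0 < 2 + 2 * (L * ρ) / r by positivity), ← Real.exp_nat_mul,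
      ← Real.exp_nat_mul, Real.log_exp]
    push_cast
    ring_nf
  rw [hbase, hexp]
  gcongr
  exact one_add_mul_two_pow_le (by positivity) i

theorem holdsWithProbGE_stableRecovery [DecidableEq ι] {m : ℕ} (hL : 0 < L)
    (hf : LipschitzOnWith L f (closedBall 0 ρ)) (hρ : 0 ≤ ρ) (hδ : 0 < δ)
    (hm : 600 * (finrank ℝ E * Real.log (2 + 20 * (L * ρ) / δ)) ≤ m)
    {u : EuclideanSpace ℝ ι} (hu : u ∈ f '' closedBall 0 ρ) (x : EuclideanSpace ℝ ι) :
    HoldsWithProbGE (gaussianMatrix m ι) (1 - Real.exp (-(1 / 200) * m)) fun A ↦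
      StableRecovery (Matrix.toEuclideanLin (Matrix.of A)) (f '' closedBall 0 ρ) u x δ := by
  obtain hE | hE := subsingleton_or_nontrivial E
  · refine .of_forall (Real.exp_nonneg _) fun A ↦ stableRecovery_of_norm_sub_le ?_
    obtain ⟨a, -, rfl⟩ := hu
    rintro _ ⟨b, -, rfl⟩
    rw [Subsingleton.elim b a, sub_self, norm_zero]
    positivity
  lift δ to ℝ≥0 using hδ.le
  have hr : 0 < δ / 10 := div_pos hδ (by norm_num)
  have hscale : 2 * (L * ρ) / (δ / 10 : ℝ≥0) = 20 * (L * ρ) / δ := by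
    push_cast
    field_simp
    ring
  choose S hS hcard using fun i ↦ exists_isCover_card_le_exp hL hf hρ hr i
  simp_rw [hscale] at hcard
  have hlog : Real.log 2 ≤ finrank ℝ E * Real.log (2 + 20 * (L * ρ) / δ) := by
    have hfinrank : (1 : ℝ) ≤ finrank ℝ E := mod_cast finrank_pos (R := ℝ) (M := E)
    have hratio : 0 ≤ 20 * (L * ρ) / δ := by positivity
    calc Real.log 2 ≤ Real.log (2 + 20 * (L * ρ) / δ) := by
          gcongr
          linarith
      _ ≤ _ := le_mul_of_one_le_left (Real.log_nonneg (by linarith)) hfinrank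
  refine .of_notMem (measurableSet_failureEvent S u x) (Real.exp_nonneg _)
    (gaussianMatrix_failureEvent_le hlog hm hcard u x) fun A hA ↦ ?_
  obtain ⟨heigen, hmisfit⟩ := restrictedEigenvalue_of_notMem_failureEvent hS hA
  have hslack : 13 * ((δ / 10 : ℝ≥0) : ℝ) = 13 / 10 * δ := by
    push_cast
    ring
  exact (hslack ▸ heigen).stableRecovery hu hδ.le hmisfit

end Recovery

section FrobeniusNorm

open scoped Matrix.Norms.L2Operator

variable {P Q S : Type*} [Fintype P] [Fintype Q] [Fintype S]

/-- The entries of a matrix as a vector, so that the Euclidean norm is the Frobenius norm. -/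
def entries (B : Matrix P Q ℝ) : EuclideanSpace ℝ (P × Q) := WithLp.toLp 2 fun t ↦ B t.1 t.2

theorem norm_entries_add_le (B B' : Matrix P Q ℝ) :
    ‖entries (B + B')‖ ≤ ‖entries B‖ + ‖entries B'‖ :=
  norm_add_le (entries B) (entries B')

theorem norm_entries_sq (B : Matrix P Q ℝ) : ‖entries B‖ ^ 2 = ∑ p, ∑ q, B p q ^ 2 := by
  rw [EuclideanSpace.real_norm_sq_eq, Fintype.sum_prod_type]
  rfl

theorem norm_entries_sq_eq_sum_col (B : Matrix P Q ℝ) :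
    ‖entries B‖ ^ 2 = ∑ q, ‖(WithLp.toLp 2 (B.col q) : EuclideanSpace ℝ P)‖ ^ 2 := by
  simp_rw [norm_entries_sq, EuclideanSpace.real_norm_sq_eq]
  exact Finset.sum_comm

theorem norm_entries_le_of_abs_le {B B' : Matrix P Q ℝ} (h : ∀ p q, |B p q| ≤ |B' p q|) :
    ‖entries B‖ ≤ ‖entries B'‖ := by
  rw [← sq_le_sq₀ (norm_nonneg _) (norm_nonneg _), norm_entries_sq, norm_entries_sq]
  exact Finset.sum_le_sum fun p _ ↦ Finset.sum_le_sum fun q _ ↦ sq_le_sq.2 (h p q)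

variable [DecidableEq Q]

theorem l2_opNorm_le_norm_entries (B : Matrix P Q ℝ) : ‖B‖ ≤ ‖entries B‖ := by
  rw [Matrix.l2_opNorm_def]
  refine ContinuousLinearMap.opNorm_le_bound _ (norm_nonneg _) fun x ↦ ?_
  rw [← sq_le_sq₀ (norm_nonneg _) (by positivity), mul_pow, norm_entries_sq,
    EuclideanSpace.real_norm_sq_eq, EuclideanSpace.real_norm_sq_eq, Finset.sum_mul]
  exact Finset.sum_le_sum fun p _ ↦ Finset.sum_mul_sq_le_sq_mul_sq _ _ _

theorem norm_toLp_mulVec_le (B : Matrix P Q ℝ) (v : Q → ℝ) :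
    ‖(WithLp.toLp 2 (B.mulVec v) : EuclideanSpace ℝ P)‖
      ≤ ‖B‖ * ‖(WithLp.toLp 2 v : EuclideanSpace ℝ Q)‖ :=
  B.l2_opNorm_mulVec (WithLp.toLp 2 v)

theorem norm_entries_mul_le (B : Matrix P Q ℝ) (W : Matrix Q S ℝ) :
    ‖entries (B * W)‖ ≤ ‖B‖ * ‖entries W‖ := by
  rw [← sq_le_sq₀ (norm_nonneg _) (by positivity), mul_pow, norm_entries_sq_eq_sum_col,
    norm_entries_sq_eq_sum_col, Finset.mul_sum]
  refine Finset.sum_le_sum fun s _ ↦ ?_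
  rw [← mul_pow]
  exact pow_le_pow_left₀ (norm_nonneg _) (norm_toLp_mulVec_le B (W.col s)) 2

end FrobeniusNorm

theorem OutputMap.abs_apply_sub_le (o : OutputMap) (a b : ℝ) :
    |o.apply a - o.apply b| ≤ |a - b| := by
  cases o with
  | identity => exact le_rfl
  | sigmoid =>
    refine Convex.norm_image_sub_le_of_norm_deriv_le (C := 1) (s := Set.univ) (f := Real.sigmoid)
      (fun t _ ↦ differentiableAt_sigmoid) (fun t _ ↦ ?_) convex_univ trivial trivial
      |>.trans_eq (one_mul _)
    rw [Real.deriv_sigmoid, Real.norm_eq_abs, abs_le]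
    constructor <;> nlinarith [Real.sigmoid_pos t, Real.sigmoid_lt_one t]

section Linearity

variable {D ℓ : ℕ} {s : Fin D → ℕ}

/-- The kernel of a filter as a linear function of the learnable numbers. -/
def FilterKind.kernelₗ (F : FilterKind D ℓ) : (F.Coeff → ℝ) →ₗ[ℝ] (Fin D → Fin ℓ) → ℝ where
  toFun := F.kernel
  map_add' c c' := by
    cases F with
    | fixed w => exact funext fun q ↦ add_mul _ _ _
    | learned => rfl
  map_smul' a c := by
    cases F with
    | fixed w => exact funext fun q ↦ mul_assoc _ _ _
    | learned => rfl

/-- Upsampling as a linear map. -/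
def upsampleₗ (f : ℕ) : (Pixels s → ℝ) →ₗ[ℝ] Pixels (fun a ↦ f * s a) → ℝ where
  toFun := upsample f
  map_add' x x' := by
    ext p
    by_cases h : ∀ a, f ∣ (p a : ℕ) <;> simp [upsample, h]
  map_smul' t x := by
    ext p
    by_cases h : ∀ a, f ∣ (p a : ℕ) <;> simp [upsample, h]

/-- Circular convolution as a bilinear map. -/
def convₗ : ((Fin D → Fin ℓ) → ℝ) →ₗ[ℝ] (Pixels s → ℝ) →ₗ[ℝ] Pixels s → ℝ :=
  LinearMap.mk₂ ℝ conv
    (fun c c' z ↦ funext fun p ↦ by simp [conv, add_mul, Finset.sum_add_distrib])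
    (fun t c z ↦ funext fun p ↦ by simp [conv, mul_assoc, Finset.mul_sum])
    (fun c z z' ↦ funext fun p ↦ by simp [conv, mul_add, Finset.sum_add_distrib])
    (fun t c z ↦ funext fun p ↦ by simp [conv, mul_left_comm, Finset.mul_sum])

end Linearity

theorem mul_le_max_one_mul_div {κ μ δ a : ℝ} (hμ : 0 < μ) (hδ : 0 < δ)
    (h : 1 < κ * μ → κ * δ ≤ a) : κ * μ ≤ max 1 (a * μ / δ) := by
  rw [le_max_iff, le_div_iff₀ hδ]
  refine or_iff_not_imp_left.2 fun hone ↦ ?_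
  calc κ * μ * δ = κ * δ * μ := by ring
    _ ≤ a * μ := mul_le_mul_of_nonneg_right (h (not_le.1 hone)) hμ.le

theorem log_two_add_pow_le {d : ℕ} {R : ℝ} (hd : 1 ≤ d) (hR : 1 ≤ R) (h : 4 / 3 ≤ R ^ d) :
    Real.log (2 + 20 * (2 * R ^ (d + 1))) ≤ 15 * (d * Real.log R) := by
  have hsucc : R ^ (d + 1) ≤ (R ^ d) ^ 2 := by
    rw [← pow_mul]
    exact pow_le_pow_right₀ hR (by omega)
  have hconst : (42 : ℝ) ≤ (R ^ d) ^ 13 :=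
    le_trans (by norm_num) (pow_le_pow_left₀ (by norm_num : (0 : ℝ) ≤ 4 / 3) h 13)
  calc Real.log (2 + 20 * (2 * R ^ (d + 1)))
      ≤ Real.log ((R ^ d) ^ 15) := by
        refine Real.log_le_log (by positivity) ?_
        calc 2 + 20 * (2 * R ^ (d + 1))
            ≤ 42 * (R ^ d) ^ 2 := by linarith [one_le_pow₀ (n := 2) (one_le_pow₀ (n := d) hR)]
          _ ≤ (R ^ d) ^ 13 * (R ^ d) ^ 2 := by gcongr
          _ = (R ^ d) ^ 15 := (pow_add _ 13 2).symm
    _ = 15 * (d * Real.log R) := by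
        rw [Real.log_pow, Real.log_pow, Nat.cast_ofNat]

namespace ConvGenerator

open scoped Matrix.Norms.L2Operator

/-- The space of the learnable numbers of layer `i`, with the Euclidean norm. -/
abbrev LayerParams (G : ConvGenerator) (i : ℕ) : Type :=
  EuclideanSpace ℝ ((G.filter i).Coeff × Fin G.channels × Fin G.channels)

/-- Upsampling followed by convolution in layer `i`, as a linear operator on families of channels
indexed by the learnable numbers of one filter; `LayerNormLE` bounds its norm. -/
def channelMap (G : ConvGenerator) (i : ℕ) :
    ((G.filter i).Coeff → Pixels (G.size i) → ℝ) →ₗ[ℝ] Pixels (G.size (i + 1)) → ℝ :=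
  ∑ e, convₗ ((G.filter i).kernel (Pi.single e 1)) ∘ₗ upsampleₗ (G.factor i) ∘ₗ LinearMap.proj e

/-- The output of layer `i` before the ReLU, which is bilinear in the parameters and the volume. -/
def preactivation (G : ConvGenerator) (i : ℕ) (θ : G.LayerParams i)
    (B : Matrix (Pixels (G.size i)) (Fin G.channels) ℝ) :
    Matrix (Pixels (G.size (i + 1))) (Fin G.channels) ℝ :=
  Matrix.of fun p s ↦ G.channelMap i (fun e ↦ B.mulVec fun j ↦ θ (e, s, j)) p

variable {G : ConvGenerator} {i : ℕ}

theorem channelMap_apply (z : (G.filter i).Coeff → Pixels (G.size i) → ℝ) :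
    G.channelMap i z = ∑ e, conv ((G.filter i).kernel (Pi.single e 1))
      (upsample (G.factor i) (z e)) :=
  LinearMap.sum_apply _ _ _

theorem channelMap_smul_const (c : (G.filter i).Coeff → ℝ) (z : Pixels (G.size i) → ℝ) :
    G.channelMap i (fun e ↦ c e • z)
      = conv ((G.filter i).kernel c) (upsample (G.factor i) z) := by
  have hlinear :
      ∑ e, convₗ ((G.filter i).kernelₗ (Pi.single e 1)) (upsampleₗ (G.factor i) (c e • z))
      = convₗ ((G.filter i).kernelₗ (∑ e, c e • Pi.single e 1)) (upsampleₗ (G.factor i) z) := by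
    simp only [map_sum, map_smul, LinearMap.sum_apply, LinearMap.smul_apply]
  rw [← pi_eq_sum_univ'] at hlinear
  exact (channelMap_apply _).trans hlinear

theorem LayerNormLE.norm_channelMap_le {κ : ℝ} (h : G.LayerNormLE i κ)
    (z : (G.filter i).Coeff → EuclideanSpace ℝ (Pixels (G.size i))) :
    ‖(WithLp.toLp 2 (G.channelMap i fun e ↦ z e) : EuclideanSpace ℝ (Pixels (G.size (i + 1))))‖
      ≤ κ * √(∑ e, ‖z e‖ ^ 2) := by
  convert h z using 3
  rw [channelMap_apply]
  exact funext fun p ↦ Finset.sum_apply _ _ _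

section Layer

variable (θ θ' : G.LayerParams i) (B B' : Matrix (Pixels (G.size i)) (Fin G.channels) ℝ)

theorem layer_apply (p : Pixels (G.size (i + 1))) (s : Fin G.channels) :
    G.layer i θ B p s = max 0 (G.preactivation i θ B p s) := by
  have hmulVec : (fun e ↦ B.mulVec fun j ↦ θ (e, s, j))
      = ∑ j, fun e ↦ θ (e, s, j) • fun p' ↦ B p' j := by
    ext e p'
    simp [Matrix.mulVec, dotProduct, mul_comm]
  simp only [layer, preactivation, Matrix.of_apply, hmulVec, map_sum, channelMap_smul_const]
  exact congrArg (max 0) (Finset.sum_apply _ _ _).symm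

theorem preactivation_sub_left :
    G.preactivation i (θ - θ') B = G.preactivation i θ B - G.preactivation i θ' B := by
  ext p s
  have hsub : (fun e ↦ B.mulVec fun j ↦ (θ - θ') (e, s, j))
      = (fun e ↦ B.mulVec fun j ↦ θ (e, s, j)) - fun e ↦ B.mulVec fun j ↦ θ' (e, s, j) :=
    funext fun e ↦ B.mulVec_sub (fun j ↦ θ (e, s, j)) fun j ↦ θ' (e, s, j)
  simp only [preactivation, Matrix.of_apply, Matrix.sub_apply, hsub, map_sub, Pi.sub_apply]

theorem preactivation_sub_right :
    G.preactivation i θ (B - B') = G.preactivation i θ B - G.preactivation i θ B' := by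
  ext p s
  have hsub : (fun e ↦ (B - B').mulVec fun j ↦ θ (e, s, j))
      = (fun e ↦ B.mulVec fun j ↦ θ (e, s, j)) - fun e ↦ B'.mulVec fun j ↦ θ (e, s, j) :=
    funext fun e ↦ B.sub_mulVec B' _
  simp only [preactivation, Matrix.of_apply, Matrix.sub_apply, hsub, map_sub, Pi.sub_apply]

theorem preactivation_sub_preactivation :
    G.preactivation i θ B - G.preactivation i θ' B'
      = G.preactivation i (θ - θ') B + G.preactivation i θ' (B - B') := by
  rw [preactivation_sub_left, preactivation_sub_right, sub_add_sub_cancel]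

variable {κ : ℝ}

theorem norm_entries_preactivation_le (hκ : 0 ≤ κ) (h : G.LayerNormLE i κ) :
    ‖entries (G.preactivation i θ B)‖ ≤ κ * ‖B‖ * ‖θ‖ := by
  let w (e : (G.filter i).Coeff) (s : Fin G.channels) : EuclideanSpace ℝ (Fin G.channels) :=
    WithLp.toLp 2 fun j ↦ θ (e, s, j)
  let z (e : (G.filter i).Coeff) (s : Fin G.channels) : EuclideanSpace ℝ (Pixels (G.size i)) :=
    WithLp.toLp 2 (B.mulVec (w e s))
  have hθ : ‖θ‖ ^ 2 = ∑ s, ∑ e, ‖w e s‖ ^ 2 := by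
    simp_rw [w, EuclideanSpace.real_norm_sq_eq, Fintype.sum_prod_type]
    exact Finset.sum_comm
  rw [← sq_le_sq₀ (norm_nonneg _) (by positivity), mul_pow, norm_entries_sq_eq_sum_col, hθ,
    Finset.mul_sum]
  refine Finset.sum_le_sum fun s _ ↦ ?_
  calc _ ≤ (κ * √(∑ e, ‖z e s‖ ^ 2)) ^ 2 :=
        pow_le_pow_left₀ (norm_nonneg _) (h.norm_channelMap_le fun e ↦ z e s) 2
    _ = κ ^ 2 * ∑ e, ‖z e s‖ ^ 2 := by
        rw [mul_pow, Real.sq_sqrt (Finset.sum_nonneg fun _ _ ↦ sq_nonneg _)]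
    _ ≤ κ ^ 2 * ∑ e, (‖B‖ * ‖w e s‖) ^ 2 := by
        gcongr with e
        exact norm_toLp_mulVec_le B (w e s)
    _ = (κ * ‖B‖) ^ 2 * ∑ e, ‖w e s‖ ^ 2 := by simp_rw [mul_pow, ← Finset.mul_sum, mul_assoc]

theorem norm_layer_le (hκ : 0 ≤ κ) (h : G.LayerNormLE i κ) :
    ‖G.layer i θ B‖ ≤ κ * ‖B‖ * ‖θ‖ := by
  refine (l2_opNorm_le_norm_entries _).trans
    ((norm_entries_le_of_abs_le fun p s ↦ ?_).trans (norm_entries_preactivation_le θ B hκ h))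
  rw [layer_apply, abs_of_nonneg (le_max_left _ _)]
  exact max_le (abs_nonneg _) (le_abs_self _)

theorem norm_layer_sub_layer_le (hκ : 0 ≤ κ) (h : G.LayerNormLE i κ) :
    ‖G.layer i θ B - G.layer i θ' B'‖ ≤ κ * ‖B‖ * ‖θ - θ'‖ + κ * ‖B - B'‖ * ‖θ'‖ :=
  calc ‖G.layer i θ B - G.layer i θ' B'‖
      ≤ ‖entries (G.layer i θ B - G.layer i θ' B')‖ := l2_opNorm_le_norm_entries _
    _ ≤ ‖entries (G.preactivation i θ B - G.preactivation i θ' B')‖ := by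
        refine norm_entries_le_of_abs_le fun p s ↦ ?_
        simp only [Matrix.sub_apply, layer_apply, max_comm (0 : ℝ)]
        exact abs_max_sub_max_le_abs _ _ _
    _ ≤ ‖entries (G.preactivation i (θ - θ') B)‖ + ‖entries (G.preactivation i θ' (B - B'))‖ := by
        rw [preactivation_sub_preactivation]
        exact norm_entries_add_le _ _
    _ ≤ κ * ‖B‖ * ‖θ - θ'‖ + κ * ‖B - B'‖ * ‖θ'‖ :=
        add_le_add (norm_entries_preactivation_le _ _ hκ h)
          (norm_entries_preactivation_le _ _ hκ h)

end Layer

section Generator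

open Metric

/-- The part of the parameter vector that belongs to layer `i`. -/
def layerParams (C : G.Params) (i : Fin G.depth) : G.LayerParams i :=
  WithLp.toLp 2 fun t ↦ C (Sum.inl ⟨i, t⟩)

/-- The part of the parameter vector that belongs to the final linear combinations. -/
def outWeights (C : G.Params) : Matrix (Fin G.channels) (Fin G.outChannels) ℝ :=
  Matrix.of fun j o ↦ C (Sum.inr (j, o))

section Params

variable (C C' : G.Params)

theorem norm_sq_eq_sum_layerParams_add_outWeights :
    ‖C‖ ^ 2 = ∑ i, ‖layerParams C i‖ ^ 2 + ‖entries (outWeights C)‖ ^ 2 := by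
  simp_rw [EuclideanSpace.real_norm_sq_eq, Fintype.sum_sum_type, Fintype.sum_sigma]
  rfl

theorem norm_sq_layerParams_add_norm_sq_outWeights_le (i : Fin G.depth) :
    ‖layerParams C i‖ ^ 2 + ‖entries (outWeights C)‖ ^ 2 ≤ ‖C‖ ^ 2 := by
  rw [norm_sq_eq_sum_layerParams_add_outWeights]
  gcongr
  exact Finset.single_le_sum (f := fun i ↦ ‖layerParams C i‖ ^ 2) (fun _ _ ↦ sq_nonneg _)
    (Finset.mem_univ i)

theorem norm_layerParams_le (i : Fin G.depth) : ‖layerParams C i‖ ≤ ‖C‖ := by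
  refine le_of_sq_le_sq ?_ (norm_nonneg _)
  linarith [norm_sq_layerParams_add_norm_sq_outWeights_le C i,
    sq_nonneg ‖entries (outWeights C)‖]

theorem norm_entries_outWeights_le : ‖entries (outWeights C)‖ ≤ ‖C‖ := by
  refine le_of_sq_le_sq ?_ (norm_nonneg _)
  rw [norm_sq_eq_sum_layerParams_add_outWeights]
  exact le_add_of_nonneg_left (Finset.sum_nonneg fun _ _ ↦ sq_nonneg _)

theorem norm_generate_sub_generate_le :
    ‖G.generate C - G.generate C'‖ ≤ ‖entries (G.volume C G.depth le_rfl * outWeights C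
      - G.volume C' G.depth le_rfl * outWeights C')‖ :=
  norm_entries_le_of_abs_le
    (B := Matrix.of fun p o ↦ G.generate C (p, o) - G.generate C' (p, o))
    fun _ _ ↦ OutputMap.abs_apply_sub_le _ _ _

end Params

theorem inputNorm_nonneg : 0 ≤ G.inputNorm := norm_nonneg G.input

variable {κ μ : ℝ} {C C' : G.Params}

theorem norm_volume_le (hκ : 0 ≤ κ) (h : ∀ i < G.depth, G.LayerNormLE i κ) (hC : ‖C‖ ≤ μ) {i : ℕ}
    (hi : i ≤ G.depth) : ‖G.volume C i hi‖ ≤ G.inputNorm * (κ * μ) ^ i := by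
  have hμ : 0 ≤ μ := (norm_nonneg _).trans hC
  induction i with
  | zero => exact (mul_one G.inputNorm).ge
  | succ i ih =>
    have hinput := G.inputNorm_nonneg
    calc ‖G.volume C (i + 1) hi‖
        ≤ κ * ‖G.volume C i (Nat.le_of_succ_le hi)‖ * ‖layerParams C ⟨i, hi⟩‖ :=
          norm_layer_le (layerParams C ⟨i, hi⟩) _ hκ (h i hi)
      _ ≤ κ * (G.inputNorm * (κ * μ) ^ i) * μ := by
          gcongr
          exacts [ih _, (norm_layerParams_le C _).trans hC]
      _ = G.inputNorm * (κ * μ) ^ (i + 1) := by ring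

theorem norm_volume_sub_volume_mul_le (hκ : 0 ≤ κ) (h : ∀ i < G.depth, G.LayerNormLE i κ)
    (hC : ‖C‖ ≤ μ) (hC' : ‖C'‖ ≤ μ) {i : ℕ} (hi : i ≤ G.depth) :
    ‖G.volume C i hi - G.volume C' i hi‖ * μ ≤ i * (G.inputNorm * (κ * μ) ^ i) * ‖C - C'‖ := by
  have hμ : 0 ≤ μ := (norm_nonneg _).trans hC
  induction i with
  | zero =>
    have hinputs : G.volume C 0 hi = G.volume C' 0 hi := rfl
    simp only [hinputs, sub_self, norm_zero, Nat.cast_zero, zero_mul, le_refl]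
  | succ i ih =>
    have hinput := G.inputNorm_nonneg
    have hi' := Nat.le_of_succ_le hi
    have hlayer : ‖G.volume C (i + 1) hi - G.volume C' (i + 1) hi‖
        ≤ κ * (G.inputNorm * (κ * μ) ^ i) * ‖C - C'‖
          + κ * ‖G.volume C i hi' - G.volume C' i hi'‖ * μ := by
      refine (norm_layer_sub_layer_le (layerParams C ⟨i, hi⟩) (layerParams C' ⟨i, hi⟩) _ _ hκ
        (h i hi)).trans ?_
      gcongr
      exacts [norm_volume_le hκ h hC hi', norm_layerParams_le (C - C') ⟨i, hi⟩,
        (norm_layerParams_le C' _).trans hC']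
    calc ‖G.volume C (i + 1) hi - G.volume C' (i + 1) hi‖ * μ
        ≤ (κ * (G.inputNorm * (κ * μ) ^ i) * ‖C - C'‖
          + κ * ‖G.volume C i hi' - G.volume C' i hi'‖ * μ) * μ := by gcongr
      _ = κ * μ * (G.inputNorm * (κ * μ) ^ i * ‖C - C'‖
          + ‖G.volume C i hi' - G.volume C' i hi'‖ * μ) := by ring
      _ ≤ κ * μ * (G.inputNorm * (κ * μ) ^ i * ‖C - C'‖
          + i * (G.inputNorm * (κ * μ) ^ i) * ‖C - C'‖) :=
        mul_le_mul_of_nonneg_left (add_le_add_right (ih hi') _) (by positivity)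
      _ = (i + 1 : ℕ) * (G.inputNorm * (κ * μ) ^ (i + 1)) * ‖C - C'‖ := by
        push_cast
        ring

theorem lipschitzOnWith_generate (hκ : 0 ≤ κ) (h : ∀ i < G.depth, G.LayerNormLE i κ) :
    LipschitzOnWith ((G.depth + 1) * (G.inputNorm * (κ * μ) ^ G.depth)).toNNReal G.generate
      (closedBall 0 μ) := by
  refine LipschitzOnWith.of_dist_le' fun C hC C' hC' ↦ ?_
  rw [mem_closedBall_zero_iff] at hC hC'
  rw [dist_eq_norm, dist_eq_norm]
  have hinput := G.inputNorm_nonneg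
  have hμ : 0 ≤ μ := (norm_nonneg _).trans hC
  have hsplit : G.volume C G.depth le_rfl * outWeights C
        - G.volume C' G.depth le_rfl * outWeights C'
      = G.volume C G.depth le_rfl * outWeights (C - C')
        + (G.volume C G.depth le_rfl - G.volume C' G.depth le_rfl) * outWeights C' := by
    have hsub : outWeights (C - C') = outWeights C - outWeights C' := rfl
    rw [hsub, Matrix.mul_sub, Matrix.sub_mul, sub_add_sub_cancel]
  calc ‖G.generate C - G.generate C'‖
      ≤ ‖G.volume C G.depth le_rfl‖ * ‖entries (outWeights (C - C'))‖
        + ‖G.volume C G.depth le_rfl - G.volume C' G.depth le_rfl‖ * ‖entries (outWeights C')‖ := by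
        refine (norm_generate_sub_generate_le C C').trans ?_
        rw [hsplit]
        exact (norm_entries_add_le _ _).trans
          (add_le_add (norm_entries_mul_le _ _) (norm_entries_mul_le _ _))
    _ ≤ G.inputNorm * (κ * μ) ^ G.depth * ‖C - C'‖
        + ‖G.volume C G.depth le_rfl - G.volume C' G.depth le_rfl‖ * μ := by
        gcongr
        exacts [norm_volume_le hκ h hC le_rfl, norm_entries_outWeights_le _,
          (norm_entries_outWeights_le C').trans hC']
    _ ≤ (G.depth + 1) * (G.inputNorm * (κ * μ) ^ G.depth) * ‖C - C'‖ := by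
        linarith [norm_volume_sub_volume_mul_le hκ h hC hC' le_rfl]

theorem exists_forall_norm_generate_sub_le (hκ : 0 ≤ κ) (h : ∀ i < G.depth, G.LayerNormLE i κ)
    (hμ : 0 ≤ μ) (x : G.Signal) :
    ∃ z : G.Params, ‖z‖ ≤ μ ∧ ∀ C, ‖C‖ ≤ μ → ‖G.generate z - x‖ ≤ ‖G.generate C - x‖ := by
  obtain ⟨z, hz, hmin⟩ := (isCompact_closedBall (0 : G.Params) μ).exists_isMinOn
    ⟨0, mem_closedBall_self hμ⟩
    ((lipschitzOnWith_generate hκ h).continuousOn.sub continuousOn_const).norm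
  exact ⟨z, mem_closedBall_zero_iff.1 hz, fun C hC ↦ hmin (mem_closedBall_zero_iff.2 hC)⟩

-- The last layer and the final linear combinations share the norm budget `‖C‖`, so that AM-GM
-- yields the factor `1 / 2`.
theorem norm_generate_sub_generate_zero_le (hd : 1 ≤ G.depth) (hκ : 0 ≤ κ)
    (h : ∀ i < G.depth, G.LayerNormLE i κ) (C : G.Params) :
    ‖G.generate C - G.generate 0‖ ≤ G.inputNorm * ‖C‖ * (κ * ‖C‖) ^ G.depth / 2 := by
  have hinput := G.inputNorm_nonneg
  have hgenerate : ‖G.generate C - G.generate 0‖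
      ≤ ‖G.volume C G.depth le_rfl‖ * ‖entries (outWeights C)‖ := by
    have hzero : outWeights (0 : G.Params) = 0 := rfl
    refine (norm_generate_sub_generate_le C 0).trans ?_
    rw [hzero, Matrix.mul_zero, sub_zero]
    exact norm_entries_mul_le _ _
  obtain ⟨k, hk⟩ : ∃ k, G.depth = k + 1 := ⟨G.depth - 1, by omega⟩
  have hvolume : ∀ n (hn : n ≤ G.depth), n = k + 1 → ‖G.volume C n hn‖
      ≤ κ * (G.inputNorm * (κ * ‖C‖) ^ k) * ‖layerParams C ⟨k, by omega⟩‖ := by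
    rintro _ hn rfl
    refine (norm_layer_le (layerParams C ⟨k, hn⟩) _ hκ (h k hn)).trans ?_
    gcongr
    exact norm_volume_le hκ h le_rfl (Nat.le_of_succ_le hn)
  have hbudget : ‖layerParams C ⟨k, by omega⟩‖ * ‖entries (outWeights C)‖ ≤ ‖C‖ ^ 2 / 2 := by
    linarith [two_mul_le_add_sq ‖layerParams C ⟨k, by omega⟩‖ ‖entries (outWeights C)‖,
      norm_sq_layerParams_add_norm_sq_outWeights_le C ⟨k, by omega⟩]
  calc ‖G.generate C - G.generate 0‖
      ≤ κ * (G.inputNorm * (κ * ‖C‖) ^ k) * ‖layerParams C ⟨k, by omega⟩‖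
        * ‖entries (outWeights C)‖ :=
        hgenerate.trans (mul_le_mul_of_nonneg_right (hvolume _ le_rfl hk) (norm_nonneg _))
    _ ≤ κ * (G.inputNorm * (κ * ‖C‖) ^ k) * (‖C‖ ^ 2 / 2) := by
        rw [mul_assoc]
        gcongr
    _ = G.inputNorm * ‖C‖ * (κ * ‖C‖) ^ G.depth / 2 := by
        have hpow : (κ * ‖C‖) ^ G.depth = (κ * ‖C‖) ^ (k + 1) := congrArg _ hk
        rw [hpow]
        ring

end Generator

section GeneratorRecovery

open Metric

variable {κ ξ μ δ : ℝ}

theorem norm_generate_sub_generate_zero_le_of_pow_le {q : ℝ} (hd : 1 ≤ G.depth) (hκ : 0 ≤ κ)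
    (h : ∀ i < G.depth, G.LayerNormLE i κ) (hδ : 0 ≤ δ) (hinput : G.inputNorm * μ ≤ δ * q)
    (hκμ : κ * μ ≤ q) (hq : 1 ≤ q) (hpow : q ^ G.depth ≤ 4 / 3) {C : G.Params} (hC : ‖C‖ ≤ μ) :
    ‖G.generate C - G.generate 0‖ ≤ δ := by
  have hinput_nonneg := G.inputNorm_nonneg
  have hμ : 0 ≤ μ := (norm_nonneg _).trans hC
  have hq' : q ≤ 4 / 3 := (le_self_pow₀ hq (by omega)).trans hpow
  have hinput' : G.inputNorm * μ ≤ δ * (4 / 3) := hinput.trans (by gcongr)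
  have hpow' : (κ * μ) ^ G.depth ≤ 4 / 3 := (pow_le_pow_left₀ (by positivity) hκμ _).trans hpow
  calc ‖G.generate C - G.generate 0‖
      ≤ G.inputNorm * ‖C‖ * (κ * ‖C‖) ^ G.depth / 2 :=
        norm_generate_sub_generate_zero_le hd hκ h C
    _ ≤ G.inputNorm * μ * (κ * μ) ^ G.depth / 2 := by gcongr
    _ ≤ δ * (4 / 3) * (4 / 3) / 2 := by
        linarith [mul_le_mul hinput' hpow' (by positivity) (by positivity)]
    _ ≤ δ := by linarith

theorem lipschitzOnWith_generate_of_ratio {R : ℝ} (hd : 1 ≤ G.depth) (hκ : 0 ≤ κ)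
    (h : ∀ i < G.depth, G.LayerNormLE i κ) (hμ : 0 < μ) (hR : 0 ≤ R)
    (hinput : G.depth * (G.inputNorm * μ) ≤ δ * R) (hκμ : κ * μ ≤ R) :
    LipschitzOnWith (2 * δ * R ^ (G.depth + 1) / μ).toNNReal G.generate (closedBall 0 μ) := by
  refine (lipschitzOnWith_generate hκ h).weaken (Real.toNNReal_le_toNNReal ?_)
  have hinput_nonneg := G.inputNorm_nonneg
  have hd' : (1 : ℝ) ≤ G.depth := mod_cast hd
  rw [le_div_iff₀ hμ]
  calc (G.depth + 1) * (G.inputNorm * (κ * μ) ^ G.depth) * μ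
      ≤ 2 * G.depth * (G.inputNorm * R ^ G.depth) * μ := by
        gcongr
        linarith
    _ = 2 * (G.depth * (G.inputNorm * μ)) * R ^ G.depth := by ring
    _ ≤ 2 * (δ * R) * R ^ G.depth := by gcongr
    _ = 2 * δ * R ^ (G.depth + 1) := by ring

theorem stableRecovery_generate_of_pow_le {W : Type*} [NormedAddCommGroup W] [NormedSpace ℝ W]
    {q : ℝ} (hd : 1 ≤ G.depth) (hκ : 0 ≤ κ) (h : ∀ i < G.depth, G.LayerNormLE i κ) (hδ : 0 ≤ δ)
    (hinput : G.inputNorm * μ ≤ δ * q) (hκμ : κ * μ ≤ q) (hq : 1 ≤ q)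
    (hpow : q ^ G.depth ≤ 4 / 3) {z : G.Params} (hz : ‖z‖ ≤ μ) (T : G.Signal →ₗ[ℝ] W)
    (x : G.Signal) :
    StableRecovery T (G.generate '' closedBall 0 μ) (G.generate z) x δ := by
  have hdist {C : G.Params} (hC : ‖C‖ ≤ μ) : ‖G.generate C - G.generate 0‖ ≤ δ :=
    norm_generate_sub_generate_zero_le_of_pow_le hd hκ h hδ hinput hκμ hq hpow hC
  refine stableRecovery_of_norm_sub_le ?_
  rintro _ ⟨C, hC, rfl⟩
  linarith [norm_sub_le_norm_sub_add_norm_sub (G.generate C) (G.generate 0) (G.generate z),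
    hdist (mem_closedBall_zero_iff.1 hC), norm_sub_rev (G.generate 0) (G.generate z), hdist hz]

theorem holdsWithProbGE_stableRecovery_generate_of_le_pow {R : ℝ} {m : ℕ} (hd : 1 ≤ G.depth)
    (hκ : 0 ≤ κ) (h : ∀ i < G.depth, G.LayerNormLE i κ) (hμ : 0 < μ) (hδ : 0 < δ)
    (hinput : G.depth * (G.inputNorm * μ) ≤ δ * R) (hκμ : κ * μ ≤ R) (hR : 1 ≤ R)
    (hpow : 4 / 3 ≤ R ^ G.depth) (hm : 9000 * (G.numParams * G.depth * Real.log R) ≤ m)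
    {z : G.Params} (hz : ‖z‖ ≤ μ) (x : G.Signal) :
    HoldsWithProbGE (gaussianMatrix m G.OutIndex) (1 - Real.exp (-(1 / 200) * m)) fun A ↦
      StableRecovery (Matrix.toEuclideanLin (Matrix.of A)) (G.generate '' closedBall 0 μ)
        (G.generate z) x δ := by
  have hR₀ : 0 < R := one_pos.trans_le hR
  have hL : 0 < 2 * δ * R ^ (G.depth + 1) / μ := by positivity
  have hratio : 20 * ((2 * δ * R ^ (G.depth + 1) / μ).toNNReal * μ) / δ
      = 20 * (2 * R ^ (G.depth + 1)) := by
    rw [Real.coe_toNNReal _ hL.le]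
    field_simp
  refine holdsWithProbGE_stableRecovery (Real.toNNReal_pos.2 hL)
    (lipschitzOnWith_generate_of_ratio hd hκ h hμ hR₀.le hinput hκμ) hμ.le hδ ?_
    (Set.mem_image_of_mem _ (mem_closedBall_zero_iff.2 hz)) x
  rw [hratio, finrank_euclideanSpace]
  calc 600 * (G.numParams * Real.log (2 + 20 * (2 * R ^ (G.depth + 1))))
      ≤ 600 * (G.numParams * (15 * (G.depth * Real.log R))) := by
        gcongr
        exact log_two_add_pow_le hd hR hpow
    _ = 9000 * (G.numParams * G.depth * Real.log R) := by ring
    _ ≤ m := hm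

theorem holdsWithProbGE_stableRecovery_generate (hd : 1 ≤ G.depth) (hκ : 0 ≤ κ)
    (h : ∀ i < G.depth, G.LayerNormLE i κ) (hξ : G.inputNorm ≤ ξ) (hμ : 0 < μ) (hδ : 0 < δ)
    (hκδ : 1 < κ * μ → κ * δ ≤ G.depth * ξ) {m : ℕ}
    (hm : 9000 * (G.numParams * G.depth * Real.log (G.depth * ξ * μ / δ)) ≤ m)
    {z : G.Params} (hz : ‖z‖ ≤ μ) (x : G.Signal) :
    HoldsWithProbGE (gaussianMatrix m G.OutIndex) (1 - Real.exp (-(1 / 200) * m)) fun A ↦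
      StableRecovery (Matrix.toEuclideanLin (Matrix.of A)) (G.generate '' closedBall 0 μ)
        (G.generate z) x δ := by
  set R := G.depth * ξ * μ / δ with hRdef
  have hd' : (1 : ℝ) ≤ G.depth := mod_cast hd
  have hκμ : κ * μ ≤ max 1 R := mul_le_max_one_mul_div hμ hδ hκδ
  have hinput : G.depth * (G.inputNorm * μ) ≤ δ * R := by
    calc G.depth * (G.inputNorm * μ) ≤ G.depth * (ξ * μ) := by gcongr
      _ = δ * R := by
        rw [hRdef]
        field_simp
  obtain hsmall | hlarge := le_or_gt (max 1 R ^ G.depth) (4 / 3)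
  · have hinput' : G.inputNorm * μ ≤ δ * max 1 R :=
      calc G.inputNorm * μ ≤ G.depth * (G.inputNorm * μ) :=
            le_mul_of_one_le_left (mul_nonneg G.inputNorm_nonneg hμ.le) hd'
        _ ≤ δ * max 1 R := hinput.trans (mul_le_mul_of_nonneg_left (le_max_right _ _) hδ.le)
    exact .of_forall (Real.exp_nonneg _) fun A ↦ stableRecovery_generate_of_pow_le hd hκ h hδ.le
      hinput' hκμ (le_max_left _ _) hsmall hz _ x
  · have hR : 1 < R := by
      by_contra! hle
      rw [max_eq_left hle, one_pow] at hlarge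
      norm_num at hlarge
    rw [max_eq_right hR.le] at hκμ hlarge
    exact holdsWithProbGE_stableRecovery_generate_of_le_pow hd hκ h hμ hδ hinput hκμ hR.le
      hlarge.le hm hz x

end GeneratorRecovery

end ConvGenerator

end ConvNet

theorem theorem1 :
    ∃ K : ℝ, 0 < K ∧ ∃ c : ℝ, 0 < c ∧
      ∀ (G : ConvNet.ConvGenerator) (κ ξ μ δ : ℝ) (m : ℕ) (x : G.Signal),
        1 ≤ G.depth →
        0 ≤ κ → (∀ i < G.depth, G.LayerNormLE i κ) →
        G.inputNorm ≤ ξ →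
        0 < μ → 0 < δ → (1 < κ * μ → κ * δ ≤ G.depth * ξ) →
        K * (G.numParams * G.depth * Real.log (G.depth * ξ * μ / δ)) ≤ m →
        ∃ Cstar : G.Params, ‖Cstar‖ ≤ μ ∧
          (∀ C : G.Params, ‖C‖ ≤ μ → ‖G.generate Cstar - x‖ ≤ ‖G.generate C - x‖) ∧
          ∃ E : Set (Fin m → G.OutIndex → ℝ), MeasurableSet E ∧
            ENNReal.ofReal (1 - Real.exp (-c * m)) ≤ ConvNet.gaussianMatrix m G.OutIndex E ∧
            ∀ A ∈ E, ∀ (η y : EuclideanSpace ℝ (Fin m)) (ε : ℝ) (Chat : G.Params),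
              y = Matrix.toEuclideanLin (Matrix.of A) x + η →
              ‖Chat‖ ≤ μ →
              (∀ C : G.Params, ‖C‖ ≤ μ →
                ‖y - Matrix.toEuclideanLin (Matrix.of A) (G.generate Chat)‖
                  ≤ ‖y - Matrix.toEuclideanLin (Matrix.of A) (G.generate C)‖ + ε) →
              ‖G.generate Chat - x‖
                ≤ 6 * ‖G.generate Cstar - x‖ + 3 * ‖η‖ + 2 * ε + 2 * δ := by
  refine ⟨9000, by norm_num, 1 / 200, by norm_num, ?_⟩
  intro G κ ξ μ δ m x hd hκ hlayer hξ hμ hδ hκδ hm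
  obtain ⟨z, hz, hmin⟩ := G.exists_forall_norm_generate_sub_le hκ hlayer hμ.le x
  obtain ⟨E, hE, hPE, hrec⟩ :=
    G.holdsWithProbGE_stableRecovery_generate hd hκ hlayer hξ hμ hδ hκδ hm hz x
  refine ⟨z, hz, hmin, E, hE, hPE, fun A hA η y ε C hy hC hopt ↦ ?_⟩
  exact hrec A hA η y ε _ (Set.mem_image_of_mem _ (mem_closedBall_zero_iff.2 hC)) hy
    (Set.forall_mem_image.2 fun C' hC' ↦ hopt C' (mem_closedBall_zero_iff.1 hC'))
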